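/- Let $0<p\le 1$ and $\mathbb F\in\{\mathbb R,\mathbb C\}$. A *basis* of a separable, infinite-dimensional $p$-Banach space $X$ over $\mathbb F$ (a vector space complete with respect to a $p$-norm, i.e. a definite, absolutely homogeneous function with $\|x+y\|^p\le\|x\|^p+\|y\|^p$) is a sequence $(e_n)_{n\ge 1}$ in $X$ with dense linear span for which there are (necessarily unique) bounded linear functionals $(e_n^*)_{n\ge1}$ with $e_m^*(e_n)=\delta_{m,n}$, and such that $0<\inf_n\{\|e_n\|,\|e_n^*\|\}\le\sup_n\{\|e_n\|,\|e_n^*\|\}<\infty$. For a finite set $A\subset\mathbb N=\{1,2,\dots\}$ put $P_A(x)=\sum_{n\in A}e_n^*(x)e_n$, and put $S_k=P_{\{1,\dots,k\}}$. A *greedy set of $x$ of size $m$* is a set $\Lambda\subset\mathbb N$ with $|\Lambda|=m$ and $|e_i^*(x)|\ge|e_j^*(x)|$ for all $i\in\Lambda$, $j\notin\Lambda$. A basis is *strong partially greedy* if there is $C>0$ such that $\|x-P_\Lambda(x)\|\le C\inf_{0\le k\le m}\|x-S_k(x)\|$ for all $x\in X$, $m\in\mathbb N$ and all greedy sets $\Lambda$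 of $x$ of size $m$. For a family $\mathcal F$ of finite subsets of $\mathbb N$, a basis is *$\mathcal F$-strong partially greedy* if there is $\Delta\ge1$ such that $$\|x-P_\Lambda(x)\|\le\Delta\inf\{\|x-P_F(x)\| : F\in\mathcal F,\ |F|\le m,\ i<j\text{ for all }i\in F\setminus\Lambda,\ j\in\Lambda\setminus F\}$$ for all $x\in X$, $m\ge0$ and all greedy sets $\Lambda$ of $x$ of size $m$. For a sequence $(a_n)_{n\ge1}$ of positive integers let $$\mathcal F_{(a_n)}=\{\emptyset\}\cup\{\{k+a_1,\,k+a_1+a_2,\,\dots,\,k+a_1+\cdots+a_\ell\} : k\ge0,\ \ell\ge1\}.$$ **Theorem.** Let $(a_n)_{n\ge1}$ be a sequence of positive integers. For every $0<p\le1$ and $\mathbb F\in\{\mathbb R,\mathbb C\}$, the following are equivalent: 1. The sequence $(a_n)$ is bounded. 2. For every basis of every separable, infinite-dimensional $p$-Banach space over $\mathbb F$: the basis is $\mathcal F_{(a_n)}$-strong partially greedy if and only if it is strong partially greedy. -/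

import Mathlib

universe u

/-- `X`, with the function `‖·‖` as its `p`-norm, is a `p`-Banach space over `𝕜`: the function
`‖·‖` is non-negative, definite, absolutely homogeneous and `p`-subadditive, and `X` is complete
with respect to it. (For `p = 1` these are the Banach spaces.) -/
class PBanachSpace (p : ℝ) (𝕜 : Type) (X : Type u) [RCLike 𝕜] [AddCommGroup X] [Module 𝕜 X]
    [Norm X] : Prop where
  norm_nonneg' : ∀ x : X, 0 ≤ ‖x‖
  norm_eq_zero' : ∀ x : X, ‖x‖ = 0 ↔ x = 0
  norm_smul' : ∀ (c : 𝕜) (x : X), ‖c • x‖ = ‖c‖ * ‖x‖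
  norm_add_rpow_le' : ∀ x y : X, ‖x + y‖ ^ p ≤ ‖x‖ ^ p + ‖y‖ ^ p
  complete' : ∀ v : ℕ → X,
    (∀ ε : ℝ, 0 < ε → ∃ n₀ : ℕ, ∀ m n : ℕ, n₀ ≤ m → n₀ ≤ n → ‖v m - v n‖ < ε) →
    ∃ x : X, ∀ ε : ℝ, 0 < ε → ∃ n₀ : ℕ, ∀ n : ℕ, n₀ ≤ n → ‖v n - x‖ < ε

section Basis

variable {𝕜 : Type} {X : Type u} [RCLike 𝕜] [AddCommGroup X] [Module 𝕜 X] [Norm X]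

/-- A linear functional belongs to the dual of a `p`-Banach space when it is bounded. -/
def IsBoundedFunctional (f : X →ₗ[𝕜] 𝕜) : Prop :=
  ∃ C : ℝ, ∀ x : X, ‖f x‖ ≤ C * ‖x‖

/-- The norm `sup {|f x| : ‖x‖ ≤ 1}` of a bounded linear functional. -/
noncomputable def dualNorm (f : X →ₗ[𝕜] 𝕜) : ℝ :=
  sSup {r : ℝ | ∃ x : X, ‖x‖ ≤ 1 ∧ r = ‖f x‖}

variable (𝕜 X) in
/-- A (semi-normalized) basis of a `p`-Banach space, together with its biorthogonal functionals,
which are unique because the span of the basis is dense. Indices start at `0`: the vector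
`e n` and the functional `coord n` are those with label `n + 1` in the labelling by the positive
integers. A space with such a basis is automatically separable and infinite dimensional. -/
structure SemiNormalizedBasis where
  /-- the basis vectors -/
  e : ℕ → X
  /-- the biorthogonal functionals -/
  coord : ℕ → (X →ₗ[𝕜] 𝕜)
  coord_bounded : ∀ n, IsBoundedFunctional (coord n)
  biorthogonal : ∀ m n, coord m (e n) = if m = n then 1 else 0
  dense_span : ∀ (x : X) (ε : ℝ), 0 < ε →
    ∃ y ∈ Submodule.span 𝕜 (Set.range e), ‖x - y‖ < ε
  semiNormalized : ∃ c₁ c₂ : ℝ, 0 < c₁ ∧ ∀ n,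
    (c₁ ≤ ‖e n‖ ∧ ‖e n‖ ≤ c₂) ∧ (c₁ ≤ dualNorm (coord n) ∧ dualNorm (coord n) ≤ c₂)

namespace SemiNormalizedBasis

variable (B : SemiNormalizedBasis 𝕜 X)

/-- The projection `P_A x = ∑ n ∈ A, e_n^*(x) e_n`. -/
def proj (A : Finset ℕ) (x : X) : X := ∑ n ∈ A, B.coord n x • B.e n

/-- The partial sum `S_k x` of the first `k` terms of the expansion of `x`. -/
def partialSum (k : ℕ) (x : X) : X := B.proj (Finset.range k) x

/-- `Λ` is a greedy set of `x` of cardinality `m`; then `B.proj Λ x` is a greedy sum `G_m(x)`. -/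
def IsGreedySet (x : X) (m : ℕ) (Λ : Finset ℕ) : Prop :=
  Λ.card = m ∧ ∀ i ∈ Λ, ∀ j ∉ Λ, ‖B.coord j x‖ ≤ ‖B.coord i x‖

/-- Strong partially greedy bases:
`‖x - G_m(x)‖ ≤ C inf_{0 ≤ k ≤ m} ‖x - S_k(x)‖` for all `x`, all `m ≥ 1` and all `G_m(x)`. -/
def IsStrongPartiallyGreedy : Prop :=
  ∃ C : ℝ, 0 < C ∧ ∀ (x : X) (m : ℕ) (Λ : Finset ℕ), 1 ≤ m → B.IsGreedySet x m Λ →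
    ∀ k ≤ m, ‖x - B.proj Λ x‖ ≤ C * ‖x - B.partialSum k x‖

/-- `ℱ`-strong partially greedy bases: `‖x - P_Λ(x)‖ ≤ Δ inf_F ‖x - P_F(x)‖` for all greedy sets
`Λ` of `x` of cardinality `m`, the infimum being over the `F ∈ ℱ` with `|F| ≤ m` such that every
element of `F \ Λ` is smaller than every element of `Λ \ F`. -/
def IsFamilyStrongPartiallyGreedy (ℱ : Set (Finset ℕ)) : Prop :=
  ∃ Δ : ℝ, 1 ≤ Δ ∧ ∀ (x : X) (m : ℕ) (Λ : Finset ℕ), B.IsGreedySet x m Λ →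
    ∀ F ∈ ℱ, F.card ≤ m → (∀ i ∈ F \ Λ, ∀ j ∈ Λ \ F, i < j) →
      ‖x - B.proj Λ x‖ ≤ Δ * ‖x - B.proj F x‖

end SemiNormalizedBasis

end Basis

/-- The set `k + {a₁, a₁ + a₂, …, a₁ + ⋯ + a_ℓ}` of labels, for a sequence of positive integers
`a₁ = a 0, a₂ = a 1, …`. Labels are positive integers and the label `n` has the index `n - 1`. -/
def gapSet (a : ℕ → ℕ) (k ℓ : ℕ) : Finset ℕ :=
  (Finset.range ℓ).image fun i => k + (∑ j ∈ Finset.range (i + 1), a j) - 1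

/-- The family of the empty set and all sets `k + {a₁, a₁ + a₂, …, a₁ + ⋯ + a_ℓ}`
with `k ≥ 0` and `ℓ ≥ 1`. -/
def gapFamily (a : ℕ → ℕ) : Set (Finset ℕ) :=
  {∅} ∪ {F | ∃ k ℓ : ℕ, 1 ≤ ℓ ∧ F = gapSet a k ℓ}

/-! Strong partial greediness is the family property for initial segments
(`isStrongPartiallyGreedy_iff`). For every family, the property follows from quasi-greediness
together with domination of left projections by right ones
(`isFamilyStrongPartiallyGreedy_of_isDominatedBy`). Conversely, a member of the family that contains
`D` and avoids `E` gives `‖P_D x‖ ≤ Δ‖P_E x‖` (`norm_proj_le_of_subset`).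

If the gaps are bounded by `M`, the translates by less than `M` cover all but fewer than `M`
indices. So `D` splits into boundedly many pieces, each a singleton or part of a truncated gap set,
and domination follows. If the gaps are unbounded, some infinite `D` with infinite complement meets
each gap set at most once, and the canonical basis of `ℓ₁(D) ⊕ c₀(Dᶜ)` separates the two properties.
-/

namespace PBanachSpace

/-! ### Elementary facts on `p`-norms. -/

section

variable {p : ℝ} {𝕜 : Type} {X : Type u} [RCLike 𝕜] [AddCommGroup X] [Module 𝕜 X] [Norm X]

lemma norm_zero_eq (hX : PBanachSpace p 𝕜 X) : ‖(0 : X)‖ = 0 :=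
  (hX.norm_eq_zero' 0).2 rfl

lemma norm_neg_eq (hX : PBanachSpace p 𝕜 X) (x : X) : ‖-x‖ = ‖x‖ := by
  have h := hX.norm_smul' (-1) x
  simpa using h

/-- A `p`-norm is a quasi-norm. -/
lemma exists_norm_add_le (hX : PBanachSpace p 𝕜 X) (hp : 0 < p) :
    ∃ κ : ℝ, 1 ≤ κ ∧ ∀ (x y : X) (s t : ℝ), ‖x‖ ≤ s → ‖y‖ ≤ t → ‖x + y‖ ≤ κ * (s + t) := by
  refine ⟨(2 : ℝ) ^ p⁻¹, Real.one_le_rpow (by norm_num) (by positivity), ?_⟩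
  intro x y s t hx hy
  have hx0 := hX.norm_nonneg' x
  have hy0 := hX.norm_nonneg' y
  have h1 : ‖x‖ ^ p ≤ (s + t) ^ p := Real.rpow_le_rpow hx0 (by linarith) hp.le
  have h2 : ‖y‖ ^ p ≤ (s + t) ^ p := Real.rpow_le_rpow hy0 (by linarith) hp.le
  have h3 : ‖x + y‖ ^ p ≤ ((2 : ℝ) ^ p⁻¹ * (s + t)) ^ p := by
    rw [Real.mul_rpow (by positivity) (by linarith), Real.rpow_inv_rpow (by norm_num) hp.ne']
    linarith [hX.norm_add_rpow_le' x y]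
  exact (Real.rpow_le_rpow_iff (hX.norm_nonneg' _)
    (mul_nonneg (by positivity) (by linarith)) hp).1 h3

lemma exists_norm_sum_range_le (hX : PBanachSpace p 𝕜 X) (hp : 0 < p) (N : ℕ) :
    ∃ K : ℝ, 1 ≤ K ∧ ∀ (f : ℕ → X) (t : ℝ), 0 ≤ t → (∀ c < N, ‖f c‖ ≤ t) →
      ‖∑ c ∈ Finset.range N, f c‖ ≤ K * t := by
  obtain ⟨κ, hκ, hadd⟩ := hX.exists_norm_add_le hp
  induction N with
  | zero => exact ⟨1, le_rfl, fun f t ht _ => by simpa [hX.norm_zero_eq] using ht⟩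
  | succ N ih =>
    obtain ⟨K, hK, h⟩ := ih
    refine ⟨κ * (K + 1), by nlinarith, fun f t ht hf => ?_⟩
    rw [Finset.sum_range_succ]
    refine (hadd _ _ _ _ (h f t ht fun c hc => hf c (by omega)) (hf N (by omega))).trans
      (le_of_eq (by ring))

lemma norm_apply_le_dualNorm (hX : PBanachSpace p 𝕜 X) {f : X →ₗ[𝕜] 𝕜}
    (hf : IsBoundedFunctional f) (x : X) : ‖f x‖ ≤ dualNorm f * ‖x‖ := by
  obtain ⟨C, hC⟩ := hf
  have hbdd : BddAbove {r : ℝ | ∃ x : X, ‖x‖ ≤ 1 ∧ r = ‖f x‖} := by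
    refine ⟨|C|, ?_⟩
    rintro r ⟨y, hy, rfl⟩
    have := hX.norm_nonneg' y
    calc ‖f y‖ ≤ C * ‖y‖ := hC y
      _ ≤ |C| * ‖y‖ := by gcongr; exact le_abs_self C
      _ ≤ |C| * 1 := by gcongr
      _ = |C| := mul_one _
  rcases eq_or_ne x 0 with rfl | hx
  · simp [hX.norm_zero_eq]
  have hx0 : 0 < ‖x‖ := lt_of_le_of_ne (hX.norm_nonneg' x)
    fun h => hx ((hX.norm_eq_zero' x).1 h.symm)
  have h1 : ‖((‖x‖⁻¹ : ℝ) : 𝕜)‖ = ‖x‖⁻¹ := by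
    rw [RCLike.norm_ofReal, abs_of_pos (inv_pos.2 hx0)]
  have h2 : ‖f (((‖x‖⁻¹ : ℝ) : 𝕜) • x)‖ ≤ dualNorm f := by
    refine le_csSup hbdd ⟨_, ?_, rfl⟩
    rw [hX.norm_smul', h1, inv_mul_cancel₀ hx0.ne']
  rw [map_smul, norm_smul, h1] at h2
  rwa [inv_mul_le_iff₀ hx0, mul_comm] at h2

end

end PBanachSpace

/-! ### Projections, domination and family greediness. -/

namespace SemiNormalizedBasis

section

variable {p : ℝ} {𝕜 : Type} {X : Type u} [RCLike 𝕜] [AddCommGroup X] [Module 𝕜 X] [Norm X]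
  (B : SemiNormalizedBasis 𝕜 X)

@[simp] lemma proj_empty (x : X) : B.proj ∅ x = 0 := by simp [proj]

@[simp] lemma coord_proj (A : Finset ℕ) (x : X) (n : ℕ) :
    B.coord n (B.proj A x) = if n ∈ A then B.coord n x else 0 := by
  simp [proj, B.biorthogonal]

lemma coord_sub_proj (A : Finset ℕ) (x : X) (n : ℕ) :
    B.coord n (x - B.proj A x) = if n ∈ A then 0 else B.coord n x := by
  rw [map_sub, coord_proj]; split_ifs <;> simp

lemma proj_congr {A : Finset ℕ} {x y : X} (h : ∀ n ∈ A, B.coord n x = B.coord n y) :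
    B.proj A x = B.proj A y :=
  Finset.sum_congr rfl fun n hn => by rw [h n hn]

lemma proj_union {A A' : Finset ℕ} (h : Disjoint A A') (x : X) :
    B.proj (A ∪ A') x = B.proj A x + B.proj A' x :=
  Finset.sum_union h

/-- If `E` lies to the right of `D`, has at least as many elements and carries larger coefficients
of `x`, then the projection on `E` dominates that on `D` up to the constant `K`. -/
def IsDominatedBy (K : ℝ) (x : X) (D E : Finset ℕ) : Prop :=
  D.card ≤ E.card → (∀ i ∈ D, ∀ j ∈ E, i < j) →
    (∀ i ∈ D, ∀ j ∈ E, ‖B.coord i x‖ ≤ ‖B.coord j x‖) → ‖B.proj D x‖ ≤ K * ‖B.proj E x‖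

variable {B}

/-- Fill `F \ D` with the smallest modulus `t` of a coefficient on `E`. For the resulting `y`, the
set `E ∪ F \ D` is greedy; removing it leaves `P_D x`, while removing `F` leaves `P_E x`. -/
lemma norm_proj_le_of_subset {Δ : ℝ} {D E F : Finset ℕ} {x : X}
    (hF : ∀ (y : X) (Λ : Finset ℕ), B.IsGreedySet y Λ.card Λ → F.card ≤ Λ.card →
      (∀ i ∈ F \ Λ, ∀ j ∈ Λ \ F, i < j) → ‖y - B.proj Λ y‖ ≤ Δ * ‖y - B.proj F y‖)
    (hE : E.Nonempty) (hDF : D ⊆ F) (hEF : Disjoint E F) (hcard : D.card ≤ E.card)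
    (hlt : ∀ i ∈ D, ∀ j ∈ E, i < j)
    (hle : ∀ i ∈ D, ∀ j ∈ E, ‖B.coord i x‖ ≤ ‖B.coord j x‖) :
    ‖B.proj D x‖ ≤ Δ * ‖B.proj E x‖ := by
  obtain ⟨j₀, hj₀, hmin⟩ := E.exists_min_image (fun j => ‖B.coord j x‖) hE
  set t : ℝ := ‖B.coord j₀ x‖ with ht
  have hED : Disjoint E D := hEF.mono_right hDF
  have hEG : Disjoint E (F \ D) := hEF.mono_right Finset.sdiff_subset
  have hDG : Disjoint D (F \ D) := Finset.disjoint_sdiff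
  have hFu : F = D ∪ F \ D := by rw [Finset.union_sdiff_of_subset hDF]
  set g : X := ∑ n ∈ F \ D, (t : 𝕜) • B.e n with hg
  have cg : ∀ n, B.coord n g = if n ∈ F \ D then (t : 𝕜) else 0 := by
    intro n; simp [hg, B.biorthogonal]
  set y : X := B.proj E x + B.proj D x + g with hy
  have cy : ∀ n, B.coord n y = (if n ∈ E then B.coord n x else 0) +
      (if n ∈ D then B.coord n x else 0) + if n ∈ F \ D then (t : 𝕜) else 0 := by
    intro n; rw [hy, map_add, map_add, coord_proj, coord_proj, cg]
  have cE : ∀ n ∈ E, B.coord n y = B.coord n x := by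
    intro n hn
    rw [cy, if_pos hn, if_neg (Finset.disjoint_left.1 hED hn),
      if_neg (Finset.disjoint_left.1 hEG hn)]; simp
  have cD : ∀ n ∈ D, B.coord n y = B.coord n x := by
    intro n hn
    rw [cy, if_neg (Finset.disjoint_right.1 hED hn), if_pos hn,
      if_neg (Finset.disjoint_left.1 hDG hn)]; simp
  have cG : ∀ n ∈ F \ D, B.coord n y = (t : 𝕜) := by
    intro n hn
    rw [cy, if_neg (Finset.disjoint_right.1 hEG hn), if_neg (Finset.disjoint_right.1 hDG hn),
      if_pos hn]; simp
  have pE : B.proj E y = B.proj E x := B.proj_congr cE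
  have pD : B.proj D y = B.proj D x := B.proj_congr cD
  have pG : B.proj (F \ D) y = g :=
    Finset.sum_congr rfl fun n hn => by rw [cG n hn]
  have hΛ : y - B.proj (E ∪ F \ D) y = B.proj D x := by
    rw [proj_union _ hEG, pE, pG, hy]; abel
  have hFy : y - B.proj F y = B.proj E x := by
    rw [hFu, proj_union _ hDG, pD, pG, hy]; abel
  have key := hF y (E ∪ F \ D) ⟨rfl, ?_⟩ ?_ ?_
  · rwa [hΛ, hFy] at key
  · intro i hi j hj
    have h1 : t ≤ ‖B.coord i y‖ := by
      rcases Finset.mem_union.1 hi with hi | hi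
      · rw [cE i hi]; exact hmin i hi
      · rw [cG i hi, RCLike.norm_ofReal]; exact le_abs_self t
    refine le_trans ?_ h1
    simp only [Finset.mem_union, not_or] at hj
    by_cases hjD : j ∈ D
    · rw [cD j hjD]; exact hle j hjD j₀ hj₀
    · rw [cy, if_neg hj.1, if_neg hjD, if_neg hj.2]; simp [ht]
  · rw [Finset.card_union_of_disjoint hEG, hFu, Finset.card_union_of_disjoint hDG, ← hFu]; omega
  · intro i hi j hj
    simp only [Finset.mem_sdiff, Finset.mem_union, not_or, not_and, not_not] at hi hj
    exact hlt i (hi.2.2 hi.1) j (hj.1.resolve_right fun h => hj.2 h.1)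

/-- Quasi-greedy bases for which right projections dominate left ones
are strong partially greedy for every family of finite sets. -/
lemma isFamilyStrongPartiallyGreedy_of_isDominatedBy (hX : PBanachSpace p 𝕜 X) (hp : 0 < p)
    {Δ K : ℝ} (hΔ : 1 ≤ Δ) (hK : 0 ≤ K)
    (hquasi : ∀ (x : X) (Λ : Finset ℕ), B.IsGreedySet x Λ.card Λ → ‖x - B.proj Λ x‖ ≤ Δ * ‖x‖)
    (hdom : ∀ (x : X) (D E : Finset ℕ), B.IsDominatedBy K x D E) (ℱ : Set (Finset ℕ)) :
    B.IsFamilyStrongPartiallyGreedy ℱ := by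
  obtain ⟨κ, hκ, hadd⟩ := hX.exists_norm_add_le hp
  have hΔ0 : 0 ≤ Δ := by linarith
  have hκ0 : 0 ≤ κ := by linarith
  refine ⟨κ * (Δ + K * (κ * (1 + Δ))), ?_, ?_⟩
  · have : 0 ≤ K * (κ * (1 + Δ)) := by positivity
    nlinarith
  rintro x m Λ ⟨rfl, hgr⟩ F - hcard hlt
  set y : X := x - B.proj F x with hy
  have hy0 := hX.norm_nonneg' y
  have cy : ∀ n, B.coord n y = if n ∈ F then 0 else B.coord n x := B.coord_sub_proj F x
  have pE : B.proj (Λ \ F) y = B.proj (Λ \ F) x :=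
    B.proj_congr fun n hn => by rw [cy, if_neg (Finset.mem_sdiff.1 hn).2]
  have hg : B.IsGreedySet y (Λ \ F).card (Λ \ F) := by
    refine ⟨rfl, fun i hi j hj => ?_⟩
    rw [Finset.mem_sdiff] at hi hj
    rw [cy, cy, if_neg hi.2]
    split_ifs with h
    · simp
    · exact hgr i hi.1 j fun h' => hj ⟨h', h⟩
  have h1 := hquasi y _ hg
  rw [pE] at h1
  have h2 : ‖B.proj (Λ \ F) x‖ ≤ κ * (‖y‖ + Δ * ‖y‖) := by
    have : B.proj (Λ \ F) x = y + -(y - B.proj (Λ \ F) x) := by abel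
    rw [this]
    exact hadd _ _ _ _ le_rfl (by rw [hX.norm_neg_eq]; exact h1)
  have hcard' : (F \ Λ).card ≤ (Λ \ F).card := by
    have := Finset.card_sdiff_add_card_inter F Λ
    have := Finset.card_sdiff_add_card_inter Λ F
    rw [Finset.inter_comm] at this
    omega
  have h3 : ‖B.proj (F \ Λ) x‖ ≤ K * (κ * (‖y‖ + Δ * ‖y‖)) := by
    refine (hdom x (F \ Λ) (Λ \ F) hcard' hlt fun i hi j hj => ?_).trans (by gcongr)
    rw [Finset.mem_sdiff] at hi hj
    exact hgr j hj.1 i hi.2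
  -- `Λ \ F` is greedy for `y = x - P_F x`, so quasi-greediness controls the first summand;
  -- domination by `P_{Λ \ F} x` controls the second.
  have hsplit : x - B.proj Λ x = (y - B.proj (Λ \ F) x) + B.proj (F \ Λ) x := by
    have e1 : B.proj Λ x = B.proj (Λ \ F) x + B.proj (Λ ∩ F) x := by
      rw [← proj_union _ (Finset.disjoint_sdiff_inter Λ F), Finset.sdiff_union_inter]
    have e2 : B.proj F x = B.proj (F \ Λ) x + B.proj (Λ ∩ F) x := by
      rw [Finset.inter_comm, ← proj_union _ (Finset.disjoint_sdiff_inter F Λ),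
        Finset.sdiff_union_inter]
    rw [hy, e1, e2]; abel
  rw [hsplit]
  exact (hadd _ _ _ _ h1 h3).trans (le_of_eq (by ring))

lemma IsFamilyStrongPartiallyGreedy.exists_quasiGreedy {ℱ : Set (Finset ℕ)} (h0 : ∅ ∈ ℱ)
    (h : B.IsFamilyStrongPartiallyGreedy ℱ) :
    ∃ Δ : ℝ, 1 ≤ Δ ∧ ∀ (x : X) (Λ : Finset ℕ), B.IsGreedySet x Λ.card Λ →
      ‖x - B.proj Λ x‖ ≤ Δ * ‖x‖ := by
  obtain ⟨Δ, hΔ, H⟩ := h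
  exact ⟨Δ, hΔ, fun x Λ hΛ => by simpa using H x _ Λ hΛ ∅ h0 (by simp) (by simp)⟩

/-- For initial segments the order condition is automatic. The case `m = 0`, present on one side
only, is trivial and costs the `max C 1`. -/
lemma isStrongPartiallyGreedy_iff (hX : PBanachSpace p 𝕜 X) :
    B.IsStrongPartiallyGreedy ↔ B.IsFamilyStrongPartiallyGreedy (Set.range Finset.range) := by
  constructor
  · rintro ⟨C, -, h⟩
    refine ⟨max C 1, le_max_right _ _, ?_⟩
    rintro x m Λ hΛ _ ⟨k, rfl⟩ hk -
    have h0 := hX.norm_nonneg' (x - B.proj (Finset.range k) x)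
    rw [Finset.card_range] at hk
    rcases Nat.eq_zero_or_pos m with rfl | hm
    · obtain rfl : k = 0 := by omega
      obtain rfl : Λ = ∅ := Finset.card_eq_zero.1 hΛ.1
      simpa using le_mul_of_one_le_left h0 (le_max_right C 1)
    · exact (h x m Λ hm hΛ k hk).trans (by
        unfold partialSum; gcongr; exact le_max_left _ _)
  · rintro ⟨Δ, hΔ, h⟩
    refine ⟨Δ, by linarith, fun x m Λ _ hΛ k hk => ?_⟩
    refine h x m Λ hΛ _ ⟨k, rfl⟩ (by simpa using hk) fun i hi j hj => ?_
    simp only [Finset.mem_sdiff, Finset.mem_range, not_lt] at hi hj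
    omega

/-- A strong partially greedy basis is strong partially greedy for every family. -/
theorem IsStrongPartiallyGreedy.isFamilyStrongPartiallyGreedy (hX : PBanachSpace p 𝕜 X)
    (hp : 0 < p) (h : B.IsStrongPartiallyGreedy) (ℱ : Set (Finset ℕ)) :
    B.IsFamilyStrongPartiallyGreedy ℱ := by
  rw [isStrongPartiallyGreedy_iff hX] at h
  obtain ⟨Δ, hΔ, hquasi⟩ := h.exists_quasiGreedy
    (show (∅ : Finset ℕ) ∈ Set.range Finset.range from ⟨0, Finset.range_zero⟩)
  obtain ⟨K, hK, h⟩ := h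
  refine isFamilyStrongPartiallyGreedy_of_isDominatedBy hX hp hΔ (K := K) (by linarith) hquasi ?_ ℱ
  intro x D E hcard hlt hle
  rcases D.eq_empty_or_nonempty with rfl | hD
  · rw [proj_empty, hX.norm_zero_eq]
    exact mul_nonneg (by linarith) (hX.norm_nonneg' _)
  -- The shortest initial segment containing `D` avoids `E`, since `E` lies to the right of `D`.
  refine norm_proj_le_of_subset (F := Finset.range (D.max' hD + 1))
    (fun y Λ hΛ => h y _ Λ hΛ _ ⟨_, rfl⟩)
    (Finset.card_pos.1 (hD.card_pos.trans_le hcard)) ?_ ?_ hcard hlt hle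
  · intro i hi
    have := D.le_max' i hi
    rw [Finset.mem_range]; omega
  · refine Finset.disjoint_left.2 fun j hj hj' => ?_
    have := hlt _ (D.max'_mem hD) j hj
    rw [Finset.mem_range] at hj'; omega

end

end SemiNormalizedBasis

/-! ### Combinatorics of gap sets. -/

section GapSets

lemma gapSet_mem_gapFamily (a : ℕ → ℕ) (k ℓ : ℕ) : gapSet a k ℓ ∈ gapFamily a := by
  rcases Nat.eq_zero_or_pos ℓ with rfl | h
  · left; simp [gapSet]
  · exact Or.inr ⟨k, ℓ, h, rfl⟩

lemma sum_range_succ_strictMono {a : ℕ → ℕ} (ha : ∀ n, 0 < a n) :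
    StrictMono fun i => ∑ j ∈ Finset.range (i + 1), a j :=
  strictMono_nat_of_lt_succ fun i => by
    have := ha (i + 1)
    rw [Finset.sum_range_succ _ (i + 1)]; omega

/-- The elements up to `N` of an infinite gap set form a gap set. -/
lemma exists_gapSet_mem_iff {a : ℕ → ℕ} (ha : ∀ n, 0 < a n) (k N : ℕ) :
    ∃ ℓ, ∀ n, n ∈ gapSet a k ℓ ↔
      n ≤ N ∧ ∃ i, k + (∑ j ∈ Finset.range (i + 1), a j) - 1 = n := by
  set b : ℕ → ℕ := fun i => ∑ j ∈ Finset.range (i + 1), a j with hb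
  have hmono : StrictMono b := sum_range_succ_strictMono ha
  have hex : ∃ i, N < k + b i - 1 := ⟨N + 2, by have := hmono.le_apply (x := N + 2); omega⟩
  classical
  refine ⟨Nat.find hex, fun n => ?_⟩
  simp only [gapSet, Finset.mem_image, Finset.mem_range]
  constructor
  · rintro ⟨i, hi, rfl⟩
    exact ⟨not_lt.1 (Nat.find_min hex hi), i, rfl⟩
  · rintro ⟨hn, i, rfl⟩
    refine ⟨i, ?_, rfl⟩
    by_contra! h
    have h1 := Nat.find_spec hex
    have h2 : b (Nat.find hex) ≤ b i := hmono.monotone h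
    change k + b i - 1 ≤ N at hn
    omega

/-- The translates by less than the largest gap cover everything to the right of the first gap. -/
lemma exists_gap_translate {a : ℕ → ℕ} {M : ℕ} (ha : ∀ n, 0 < a n) (hM : ∀ n, a n ≤ M) {n : ℕ}
    (hn : a 0 ≤ n + 1) :
    ∃ k < M, ∃ i, k + (∑ j ∈ Finset.range (i + 1), a j) - 1 = n := by
  set b : ℕ → ℕ := fun i => ∑ j ∈ Finset.range (i + 1), a j with hb
  have hmono : StrictMono b := sum_range_succ_strictMono ha
  have hex : ∃ i, n + 1 < b i := ⟨n + 2, hmono.le_apply (x := n + 2)⟩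
  classical
  obtain ⟨i, hi⟩ : ∃ i, Nat.find hex = i + 1 := by
    refine Nat.exists_eq_succ_of_ne_zero fun h => ?_
    have := Nat.find_spec hex
    rw [h] at this
    simp [hb] at this
    omega
  -- The label `n + 1` lies in `[b i, b (i + 1))`, so its distance to `b i` is less than `a (i + 1)
  -- ≤ M` and serves as the translation.
  have h1 : b i ≤ n + 1 := not_lt.1 (Nat.find_min hex (by omega))
  have h2 : n + 1 < b (i + 1) := hi ▸ Nat.find_spec hex
  have h3 : b (i + 1) = b i + a (i + 1) := Finset.sum_range_succ _ _
  have := hM (i + 1)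
  refine ⟨n + 1 - b i, by omega, i, ?_⟩
  change n + 1 - b i + b i - 1 = n
  omega

end GapSets

/-! ### Bounded gaps. -/

namespace SemiNormalizedBasis

theorem isStrongPartiallyGreedy_of_gapFamily {p : ℝ} {𝕜 : Type} {X : Type u} [RCLike 𝕜]
    [AddCommGroup X] [Module 𝕜 X] [Norm X] {B : SemiNormalizedBasis 𝕜 X}
    (hX : PBanachSpace p 𝕜 X) (hp : 0 < p) {a : ℕ → ℕ} (ha : ∀ n, 0 < a n)
    (hbdd : BddAbove (Set.range a)) (h : B.IsFamilyStrongPartiallyGreedy (gapFamily a)) :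
    B.IsStrongPartiallyGreedy := by
  obtain ⟨M, hM⟩ := hbdd
  replace hM : ∀ n, a n ≤ M := fun n => hM ⟨n, rfl⟩
  obtain ⟨Δ, hΔ, hquasi⟩ := h.exists_quasiGreedy (Or.inl rfl)
  obtain ⟨K, hK, h⟩ := h
  obtain ⟨c₁, c₂, hc₁, hc⟩ := B.semiNormalized
  have hc₂ : 0 ≤ c₂ := hc₁.le.trans ((hc 0).1.1.trans (hc 0).1.2)
  obtain ⟨S, hS, hsum⟩ := hX.exists_norm_sum_range_le hp (2 * M)
  rw [isStrongPartiallyGreedy_iff hX]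
  refine isFamilyStrongPartiallyGreedy_of_isDominatedBy hX hp hΔ
    (K := S * (K + c₂ * c₂)) (by positivity) hquasi ?_ _
  intro x D E hcard hlt hle
  have hPE := hX.norm_nonneg' (B.proj E x)
  rcases D.eq_empty_or_nonempty with rfl | hD
  · rw [proj_empty, hX.norm_zero_eq]
    positivity
  have hE : E.Nonempty := Finset.card_pos.1 (hD.card_pos.trans_le hcard)
  -- Colour the indices: colours below `M` are translations, and each index before the first gap
  -- point gets its own colour `M + n`.
  have hκ : ∀ n, ∃ c < 2 * M, (c < M ∧ ∃ i, c + (∑ j ∈ Finset.range (i + 1), a j) - 1 = n) ∨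
      c = M + n := by
    intro n
    rcases le_or_gt (a 0) (n + 1) with hn | hn
    · obtain ⟨k, hk, hi⟩ := exists_gap_translate ha hM hn
      exact ⟨k, by omega, Or.inl ⟨hk, hi⟩⟩
    · have := hM 0
      exact ⟨M + n, by omega, Or.inr rfl⟩
  choose κ hκlt hκ using hκ
  have hfib : B.proj D x = ∑ c ∈ Finset.range (2 * M), B.proj (D.filter fun n => κ n = c) x :=
    (Finset.sum_fiberwise_of_maps_to (fun n _ => Finset.mem_range.2 (hκlt n)) _).symm
  rw [hfib, mul_assoc]
  refine hsum _ _ (by positivity) fun c _ => ?_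
  have hsub : (D.filter fun n => κ n = c) ⊆ D := Finset.filter_subset _ _
  rcases lt_or_ge c M with hcM | hcM
  -- Truncating at `max D` keeps the gap set disjoint from `E`.
  · obtain ⟨ℓ, hℓ⟩ := exists_gapSet_mem_iff ha c (D.max' hD)
    refine (norm_proj_le_of_subset (Δ := K) (F := gapSet a c ℓ)
      (fun y Λ hΛ => h y _ Λ hΛ _ (gapSet_mem_gapFamily a c ℓ)) hE ?_ ?_
      ((Finset.card_le_card hsub).trans hcard) (fun i hi => hlt i (hsub hi))
      (fun i hi => hle i (hsub hi))).trans ?_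
    · intro n hn
      rw [Finset.mem_filter] at hn
      refine (hℓ n).2 ⟨D.le_max' n hn.1, ?_⟩
      rcases hκ n with ⟨-, hi⟩ | h'
      · rwa [hn.2] at hi
      · omega
    · refine Finset.disjoint_left.2 fun j hj hj' => ?_
      have := hlt _ (D.max'_mem hD) j hj
      have := ((hℓ j).1 hj').1
      omega
    · have : 0 ≤ c₂ * c₂ := by positivity
      gcongr; linarith
  · have hsing : (D.filter fun n => κ n = c) ⊆ {c - M} := by
      intro n hn
      rw [Finset.mem_filter] at hn
      rw [Finset.mem_singleton]
      rcases hκ n with ⟨h', -⟩ | h' <;> omega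
    rcases Finset.subset_singleton_iff.1 hsing with h0 | h0
    · rw [h0, proj_empty, hX.norm_zero_eq]; positivity
    · rw [h0]
      obtain ⟨j, hj⟩ := hE
      have hi : c - M ∈ D := hsub (h0 ▸ Finset.mem_singleton_self _)
      -- A singleton piece is controlled by one coefficient on `E`; the bounds on `e_j^*` and on the
      -- basis vector give the factor `c₂ * c₂`.
      have hcj : ‖B.coord j x‖ ≤ c₂ * ‖B.proj E x‖ := by
        have h1 := hX.norm_apply_le_dualNorm (B.coord_bounded j) (B.proj E x)
        rw [coord_proj, if_pos hj] at h1
        exact h1.trans (by gcongr; exact (hc j).2.2)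
      have hsm : ‖B.proj {c - M} x‖ = ‖B.coord (c - M) x‖ * ‖B.e (c - M)‖ := by
        rw [proj, Finset.sum_singleton, hX.norm_smul']
      rw [hsm]
      calc ‖B.coord (c - M) x‖ * ‖B.e (c - M)‖
          ≤ (c₂ * ‖B.proj E x‖) * c₂ := by
            have := hX.norm_nonneg' (B.e (c - M))
            gcongr
            · exact (hle _ hi j hj).trans hcj
            · exact (hc _).1.2
        _ ≤ (K + c₂ * c₂) * ‖B.proj E x‖ := by nlinarith

end SemiNormalizedBasis

/-! ### Unbounded gaps: a sparse set. -/

section SparseSet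

/-- If `a` is unbounded, arbitrarily far to the right there are points missed by all the gap sets
with a small translation parameter. -/
lemma exists_forall_gap_ne {a : ℕ → ℕ} (ha : ∀ n, 0 < a n) (hunb : ¬ BddAbove (Set.range a))
    (M : ℕ) : ∃ d, M + 1 < d ∧
      ∀ k ≤ M, ∀ i, k + (∑ j ∈ Finset.range (i + 1), a j) - 1 ≠ d := by
  rw [not_bddAbove_iff] at hunb
  obtain ⟨_, ⟨n, rfl⟩, hn⟩ := hunb (M + 4)
  -- This index is just left of the point ending the long gap `a n` when `k = 0`. Translating by `k
  -- ≤ M` moves that point further right, and leaves the earlier points too far left.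
  refine ⟨(∑ j ∈ Finset.range (n + 1), a j) - 2, ?_, fun k hk i h => ?_⟩
  · rw [Finset.sum_range_succ]; omega
  · have hmono : Monotone fun i => ∑ j ∈ Finset.range i, a j :=
      monotone_nat_of_le_succ fun i => by rw [Finset.sum_range_succ]; omega
    have hpos : 0 < ∑ j ∈ Finset.range (i + 1), a j := by
      rw [Finset.sum_range_succ]; have := ha i; omega
    have hs := Finset.sum_range_succ a n
    rcases lt_or_ge i n with hin | hin
    · have : ∑ j ∈ Finset.range (i + 1), a j ≤ ∑ j ∈ Finset.range n, a j := hmono hin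
      omega
    · have : ∑ j ∈ Finset.range (n + 1), a j ≤ ∑ j ∈ Finset.range (i + 1), a j :=
        hmono (Nat.succ_le_succ hin)
      omega

/-- If `a` is unbounded, some infinite set with infinite complement meets every gap set in at most
one point. -/
lemma exists_infinite_subsingleton_inter {a : ℕ → ℕ} (ha : ∀ n, 0 < a n)
    (hunb : ¬ BddAbove (Set.range a)) :
    ∃ D : Set ℕ, D.Infinite ∧ Dᶜ.Infinite ∧
      ∀ F ∈ gapFamily a, ((F : Set ℕ) ∩ D).Subsingleton := by
  choose f hf hgap using exists_forall_gap_ne ha hunb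
  set d : ℕ → ℕ := fun n => f^[n] 0 with hd
  have hsucc : ∀ n, d (n + 1) = f (d n) := fun n => Function.iterate_succ_apply' f n 0
  have hmono : StrictMono d := strictMono_nat_of_lt_succ fun n => by
    have := hf (d n); rw [hsucc]; omega
  refine ⟨Set.range d, Set.infinite_range_of_injective hmono.injective, ?_, ?_⟩
  · refine (Set.infinite_range_of_injective (f := fun n => d n + 1)
      fun m n h => hmono.injective (by simpa using h)).mono ?_
    rintro _ ⟨n, rfl⟩ ⟨m, hm⟩
    simp only at hm
    have h1 : n < m := hmono.lt_iff_lt.1 (by omega)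
    have h2 : d (n + 1) ≤ d m := hmono.monotone h1
    have := hf (d n)
    rw [hsucc] at h2
    omega
  · have key : ∀ k ℓ i j, i < j → d i ∈ gapSet a k ℓ → d j ∉ gapSet a k ℓ := by
      intro k ℓ i j hij hi hj
      simp only [gapSet, Finset.mem_image, Finset.mem_range] at hi hj
      obtain ⟨r, -, hr⟩ := hi
      obtain ⟨s, -, hs⟩ := hj
      obtain ⟨j, rfl⟩ : ∃ j', j = j' + 1 := ⟨j - 1, by omega⟩
      have hpos : 0 < ∑ j ∈ Finset.range (r + 1), a j := by
        rw [Finset.sum_range_succ]; have := ha r; omega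
      -- A gap set through `d i` has translation `k ≤ d i ≤ d j`, and `d (j + 1)` was chosen to
      -- avoid all such gap sets.
      have h1 : d i ≤ d j := hmono.monotone (by omega)
      rw [hsucc] at hs
      exact hgap (d j) k (by omega) s hs
    rintro F (hF | ⟨k, ℓ, -, rfl⟩)
    · rw [Set.mem_singleton_iff] at hF
      subst hF
      simp
    · rintro _ ⟨hx, i, rfl⟩ _ ⟨hy, j, rfl⟩
      rcases lt_trichotomy i j with h | rfl | h
      · exact absurd hy (key k ℓ i j h hx)
      · rfl
      · exact absurd hx (key k ℓ j i h hy)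

end SparseSet

/-- Subadditivity of `t ↦ t ^ p` makes every norm a `p`-norm, so one Banach space is a
counterexample for all `p`. -/
lemma PBanachSpace.of_completeSpace {p : ℝ} (hp0 : 0 < p) (hp1 : p ≤ 1) (𝕜 : Type) (X : Type u)
    [RCLike 𝕜] [NormedAddCommGroup X] [NormedSpace 𝕜 X] [CompleteSpace X] :
    PBanachSpace p 𝕜 X where
  norm_nonneg' := norm_nonneg
  norm_eq_zero' _ := norm_eq_zero
  norm_smul' := norm_smul
  norm_add_rpow_le' x y :=
    (Real.rpow_le_rpow (norm_nonneg _) (norm_add_le x y) hp0.le).trans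
      (Real.rpow_add_le_add_rpow (norm_nonneg x) (norm_nonneg y) hp0.le hp1)
  complete' v hv := by
    have hc : CauchySeq v := Metric.cauchySeq_iff.2 fun ε hε => by
      obtain ⟨n₀, h⟩ := hv ε hε
      exact ⟨n₀, fun m hm n hn => by rw [dist_eq_norm]; exact h m n hm hn⟩
    obtain ⟨x, hx⟩ := cauchySeq_tendsto_of_complete hc
    refine ⟨x, fun ε hε => ?_⟩
    obtain ⟨n₀, h⟩ := Metric.tendsto_atTop.1 hx ε hε
    exact ⟨n₀, fun n hn => by rw [← dist_eq_norm]; exact h n hn⟩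

open scoped ENNReal

/-! ### The counterexample `ℓ₁(D) ⊕ c₀(Dᶜ)`. -/

section MixedSpace

variable (𝕜 : Type) [RCLike 𝕜] (D : Set ℕ)

/-- The space `ℓ₁ × ℓ_∞`. -/
abbrev SumSupSpace : Type u :=
  ULift.{u} (lp (fun _ : ℕ => 𝕜) 1 × lp (fun _ : ℕ => 𝕜) ∞)

open Classical in
/-- The `n`-th unit vector of `ℓ_∞`, coupled with the `n`-th unit vector of `ℓ₁` if `n ∈ D`. -/
noncomputable def mixedVector (n : ℕ) : SumSupSpace.{u} 𝕜 :=
  ⟨(lp.single 1 n (if n ∈ D then 1 else 0), lp.single ∞ n 1)⟩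

/-- The direct sum of `ℓ₁(D)` and `c₀(Dᶜ)`, as the closed span of the vectors `mixedVector 𝕜 D n`
in `ℓ₁ × ℓ_∞`. -/
abbrev MixedSpace : Type u :=
  (Submodule.span 𝕜 (Set.range (mixedVector.{u} 𝕜 D))).topologicalClosure

/-- The coordinate functionals of a sequence space. -/
noncomputable def lpCoord (q : ℝ≥0∞) [Fact (1 ≤ q)] (n : ℕ) :
    lp (fun _ : ℕ => 𝕜) q →L[𝕜] 𝕜 :=
  LinearMap.mkContinuous
    { toFun := fun x => x n
      map_add' := fun _ _ => rfl
      map_smul' := fun _ _ => rfl } 1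
    fun x => by
      rw [one_mul]
      exact lp.norm_apply_le_norm (zero_lt_one.trans_le (Fact.out : 1 ≤ q)).ne' x n

@[simp] lemma lpCoord_apply (q : ℝ≥0∞) [Fact (1 ≤ q)] (n : ℕ) (x : lp (fun _ : ℕ => 𝕜) q) :
    lpCoord 𝕜 q n x = x n := rfl

namespace MixedSpace

variable {𝕜 D}

variable (𝕜 D) in
/-- The component in `ℓ₁`. -/
def fstPart : MixedSpace.{u} 𝕜 D →ₗ[𝕜] lp (fun _ : ℕ => 𝕜) 1 where
  toFun x := (x : SumSupSpace.{u} 𝕜).down.1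
  map_add' _ _ := rfl
  map_smul' _ _ := rfl

variable (𝕜 D) in
/-- The component in `ℓ_∞`. -/
def sndPart : MixedSpace.{u} 𝕜 D →ₗ[𝕜] lp (fun _ : ℕ => 𝕜) ∞ where
  toFun x := (x : SumSupSpace.{u} 𝕜).down.2
  map_add' _ _ := rfl
  map_smul' _ _ := rfl

lemma norm_eq_max (x : MixedSpace.{u} 𝕜 D) : ‖x‖ = max ‖fstPart.{u} 𝕜 D x‖ ‖sndPart.{u} 𝕜 D x‖ := rfl

lemma norm_fstPart_le (x : MixedSpace.{u} 𝕜 D) : ‖fstPart.{u} 𝕜 D x‖ ≤ ‖x‖ := le_max_left _ _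

lemma norm_sndPart_le (x : MixedSpace.{u} 𝕜 D) : ‖sndPart.{u} 𝕜 D x‖ ≤ ‖x‖ := le_max_right _ _

lemma norm_sndPart_apply_le (x : MixedSpace.{u} 𝕜 D) (n : ℕ) : ‖sndPart.{u} 𝕜 D x n‖ ≤ ‖x‖ :=
  (lp.norm_apply_le_norm ENNReal.top_ne_zero _ n).trans (norm_sndPart_le x)

variable (𝕜 D) in
/-- The vectors `mixedVector 𝕜 D n` in their closed span. -/
noncomputable def vec (n : ℕ) : MixedSpace.{u} 𝕜 D :=
  ⟨mixedVector.{u} 𝕜 D n, Submodule.le_topologicalClosure _ (Submodule.subset_span ⟨n, rfl⟩)⟩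

open Classical in
lemma fstPart_vec (n : ℕ) :
    fstPart.{u} 𝕜 D (vec.{u} 𝕜 D n) = lp.single 1 n (if n ∈ D then 1 else 0) := rfl

lemma sndPart_vec (n : ℕ) : sndPart.{u} 𝕜 D (vec.{u} 𝕜 D n) = lp.single ∞ n 1 := rfl

lemma sndPart_vec_apply (n m : ℕ) :
    sndPart.{u} 𝕜 D (vec.{u} 𝕜 D n) m = if m = n then 1 else 0 := by
  rw [sndPart_vec, lp.single_apply, Pi.single_apply]

lemma norm_vec (n : ℕ) : ‖vec.{u} 𝕜 D n‖ = 1 := by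
  rw [norm_eq_max, fstPart_vec, sndPart_vec, lp.norm_single (by simp), lp.norm_single (by simp)]
  split_ifs <;> simp

-- Both sides are continuous and linear in `x` and agree on the spanning vectors, hence on the
-- closed span. Thus the `ℓ_∞` component determines the vector.
open Classical in
lemma fstPart_apply (x : MixedSpace.{u} 𝕜 D) (n : ℕ) :
    fstPart.{u} 𝕜 D x n = if n ∈ D then sndPart.{u} 𝕜 D x n else 0 := by
  let f : SumSupSpace.{u} 𝕜 → 𝕜 := fun y => lpCoord 𝕜 1 n y.down.1
  let g : SumSupSpace.{u} 𝕜 → 𝕜 := fun y => if n ∈ D then lpCoord 𝕜 ∞ n y.down.2 else 0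
  have hf : Continuous f :=
    (lpCoord 𝕜 1 n).continuous.comp (continuous_fst.comp continuous_uliftDown)
  have hg : Continuous g := by
    by_cases h : n ∈ D
    · simp only [g, h, if_true]
      exact (lpCoord 𝕜 ∞ n).continuous.comp (continuous_snd.comp continuous_uliftDown)
    · simp only [g, h, if_false]
      exact continuous_const
  have hx : (x : SumSupSpace.{u} 𝕜) ∈
      closure (Submodule.span 𝕜 (Set.range (mixedVector.{u} 𝕜 D)) : Set (SumSupSpace.{u} 𝕜)) := by
    rw [← Submodule.topologicalClosure_coe]; exact x.2
  have hsub : (Submodule.span 𝕜 (Set.range (mixedVector.{u} 𝕜 D)) : Set (SumSupSpace.{u} 𝕜)) ⊆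
      {y | f y = g y} := by
    intro y hy
    induction hy using Submodule.span_induction with
    | mem y hy =>
      obtain ⟨m, rfl⟩ := hy
      simp only [f, g, Set.mem_ofPred_eq, mixedVector, lpCoord_apply, lp.single_apply,
        Pi.single_apply]
      split_ifs <;> simp_all
    | zero => simp [f, g]
    | add y z _ _ hy hz =>
      have e1 : f (y + z) = f y + f z := map_add (lpCoord 𝕜 1 n) _ _
      have e2 : g (y + z) = g y + g z := by
        simp only [g]; split_ifs
        · exact map_add (lpCoord 𝕜 ∞ n) _ _
        · simp
      rw [Set.mem_ofPred_eq] at hy hz ⊢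
      rw [e1, e2, hy, hz]
    | smul c y _ hy =>
      have e1 : f (c • y) = c * f y := map_smul (lpCoord 𝕜 1 n) _ _
      have e2 : g (c • y) = c * g y := by
        simp only [g]; split_ifs
        · exact map_smul (lpCoord 𝕜 ∞ n) _ _
        · simp
      rw [Set.mem_ofPred_eq] at hy ⊢
      rw [e1, e2, hy]
  exact closure_minimal hsub (isClosed_eq hf hg) hx

variable (𝕜 D) in
/-- The coordinate functionals. -/
noncomputable def coordinate (n : ℕ) : MixedSpace.{u} 𝕜 D →ₗ[𝕜] 𝕜 :=
  (lpCoord 𝕜 ∞ n : lp (fun _ : ℕ => 𝕜) ∞ →ₗ[𝕜] 𝕜) ∘ₗ sndPart.{u} 𝕜 D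

lemma coordinate_apply (n : ℕ) (x : MixedSpace.{u} 𝕜 D) :
    coordinate 𝕜 D n x = sndPart.{u} 𝕜 D x n := rfl

lemma dualNorm_coordinate (n : ℕ) : dualNorm (coordinate.{u} 𝕜 D n) = 1 := by
  refine IsGreatest.csSup_eq ⟨⟨vec 𝕜 D n, (norm_vec n).le, ?_⟩, ?_⟩
  · rw [coordinate_apply, sndPart_vec_apply, if_pos rfl, norm_one]
  · rintro _ ⟨x, hx, rfl⟩
    exact (norm_sndPart_apply_le x n).trans hx

lemma dense_span_vec (x : MixedSpace.{u} 𝕜 D) {ε : ℝ} (hε : 0 < ε) :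
    ∃ y ∈ Submodule.span 𝕜 (Set.range (vec.{u} 𝕜 D)), ‖x - y‖ < ε := by
  have hx : (x : SumSupSpace.{u} 𝕜) ∈
      closure (Submodule.span 𝕜 (Set.range (mixedVector.{u} 𝕜 D)) : Set (SumSupSpace.{u} 𝕜)) := by
    rw [← Submodule.topologicalClosure_coe]; exact x.2
  obtain ⟨y, hy', hxy⟩ := Metric.mem_closure_iff.1 hx ε hε
  refine ⟨⟨y, Submodule.le_topologicalClosure _ hy'⟩, ?_, by rwa [dist_eq_norm] at hxy⟩
  have himg : Set.range (mixedVector.{u} 𝕜 D) =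
      (Submodule.subtype _) '' Set.range (vec.{u} 𝕜 D) := by
    rw [← Set.range_comp]; rfl
  have hy := hy'
  rw [himg, SetLike.mem_coe, Submodule.span_image] at hy
  obtain ⟨z, hz, hzy⟩ := hy
  have : (⟨y, Submodule.le_topologicalClosure _ hy'⟩ : MixedSpace.{u} 𝕜 D) = z :=
    Subtype.ext hzy.symm
  rwa [this]

variable (𝕜 D) in
/-- The canonical basis of the direct sum of `ℓ₁(D)` and `c₀(Dᶜ)`. -/
noncomputable def basis : SemiNormalizedBasis 𝕜 (MixedSpace.{u} 𝕜 D) where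
  e := vec 𝕜 D
  coord := coordinate 𝕜 D
  coord_bounded n := ⟨1, fun x => by rw [one_mul]; exact norm_sndPart_apply_le x n⟩
  biorthogonal m n := sndPart_vec_apply.{u} (D := D) n m
  dense_span x _ hε := dense_span_vec x hε
  semiNormalized := ⟨1, 1, one_pos, fun n =>
    ⟨⟨(norm_vec n).ge, (norm_vec n).le⟩, (dualNorm_coordinate n).ge, (dualNorm_coordinate n).le⟩⟩

lemma norm_le_of_coord_le {x y : MixedSpace.{u} 𝕜 D}
    (h : ∀ n, ‖(basis.{u} 𝕜 D).coord n x‖ ≤ ‖(basis.{u} 𝕜 D).coord n y‖) : ‖x‖ ≤ ‖y‖ := by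
  classical
  refine max_le_max (lp.norm_mono one_ne_zero fun n => ?_)
    (lp.norm_mono ENNReal.top_ne_zero h)
  change ‖fstPart.{u} 𝕜 D x n‖ ≤ ‖fstPart.{u} 𝕜 D y n‖
  rw [fstPart_apply, fstPart_apply]
  split_ifs
  · exact h n
  · simp

open Classical in
lemma norm_fstPart_proj (A : Finset ℕ) (x : MixedSpace.{u} 𝕜 D) :
    ‖fstPart.{u} 𝕜 D ((basis.{u} 𝕜 D).proj A x)‖ = ∑ n ∈ A with n ∈ D, ‖(basis.{u} 𝕜 D).coord n x‖ := by
  have h1 : fstPart.{u} 𝕜 D ((basis.{u} 𝕜 D).proj A x) =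
      ∑ n ∈ A, lp.single 1 n (if n ∈ D then (basis.{u} 𝕜 D).coord n x else 0) := by
    rw [SemiNormalizedBasis.proj, map_sum]
    refine Finset.sum_congr rfl fun n _ => ?_
    rw [map_smul]
    change (basis.{u} 𝕜 D).coord n x • fstPart.{u} 𝕜 D (vec.{u} 𝕜 D n) = _
    rw [fstPart_vec, ← lp.single_smul]
    split_ifs <;> simp
  have h2 := lp.norm_sum_single (p := 1) (by simp)
    (fun n => if n ∈ D then (basis.{u} 𝕜 D).coord n x else (0 : 𝕜)) A
  simp only [ENNReal.toReal_one, Real.rpow_one] at h2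
  rw [h1, h2, Finset.sum_filter]
  refine Finset.sum_congr rfl fun n _ => ?_
  split_ifs <;> simp

lemma norm_sndPart_proj_le {A : Finset ℕ} {x : MixedSpace.{u} 𝕜 D} {t : ℝ} (ht : 0 ≤ t)
    (h : ∀ n ∈ A, ‖(basis.{u} 𝕜 D).coord n x‖ ≤ t) : ‖sndPart.{u} 𝕜 D ((basis.{u} 𝕜 D).proj A x)‖ ≤ t := by
  refine lp.norm_le_of_forall_le ht fun n => ?_
  have h1 : sndPart.{u} 𝕜 D ((basis.{u} 𝕜 D).proj A x) n = if n ∈ A then (basis.{u} 𝕜 D).coord n x else 0 :=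
    (basis.{u} 𝕜 D).coord_proj A x n
  rw [h1]
  split_ifs with hn
  · exact h n hn
  · simpa using ht

/-- The canonical basis is strong partially greedy for the families whose members meet `D` in at
most one point. -/
lemma isFamilyStrongPartiallyGreedy_basis {ℱ : Set (Finset ℕ)}
    (hℱ : ∀ F ∈ ℱ, ((F : Set ℕ) ∩ D).Subsingleton) :
    (basis.{u} 𝕜 D).IsFamilyStrongPartiallyGreedy ℱ := by
  classical
  refine ⟨2, by norm_num, ?_⟩
  rintro x m Λ ⟨rfl, hgr⟩ F hF hcard -
  set B := basis.{u} 𝕜 D with hB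
  have hy0 := norm_nonneg (x - B.proj F x)
  have hcoef : ∀ n ∈ F \ Λ, ‖B.coord n x‖ ≤ ‖x - B.proj F x‖ := by
    intro n hn
    rw [Finset.mem_sdiff] at hn
    -- Since `|F| ≤ |Λ|`, a point of `F \ Λ` forces one in `Λ \ F`; its coefficient is at least as
    -- large and survives in `x - P_F x`.
    obtain ⟨j, hj⟩ : (Λ \ F).Nonempty := by
      rw [Finset.sdiff_nonempty]
      intro hsub
      exact hn.2 (Finset.eq_of_subset_of_card_le hsub hcard ▸ hn.1)
    rw [Finset.mem_sdiff] at hj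
    refine (hgr j hj.1 n hn.2).trans ?_
    have h1 : B.coord j (x - B.proj F x) = B.coord j x := by
      rw [B.coord_sub_proj, if_neg hj.2]
    rw [← h1]
    exact norm_sndPart_apply_le (x - B.proj F x) j
  have hproj : ‖B.proj (F \ Λ) x‖ ≤ ‖x - B.proj F x‖ := by
    refine max_le ?_ (norm_sndPart_proj_le hy0 hcoef)
    change ‖fstPart.{u} 𝕜 D (B.proj (F \ Λ) x)‖ ≤ _
    rw [norm_fstPart_proj]
    have hle : ((F \ Λ).filter (· ∈ D)).card ≤ 1 := by
      refine Finset.card_le_one.2 fun i hi j hj => ?_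
      simp only [Finset.mem_filter, Finset.mem_sdiff] at hi hj
      exact hℱ F hF ⟨hi.1.1, hi.2⟩ ⟨hj.1.1, hj.2⟩
    calc ∑ n ∈ F \ Λ with n ∈ D, ‖B.coord n x‖
        ≤ ((F \ Λ).filter (· ∈ D)).card • ‖x - B.proj F x‖ :=
          Finset.sum_le_card_nsmul _ _ _ fun n hn => hcoef n (Finset.mem_filter.1 hn).1
      _ ≤ 1 • ‖x - B.proj F x‖ := nsmul_le_nsmul_left hy0 hle
      _ = ‖x - B.proj F x‖ := one_smul _ _
  have hunion : ‖x - B.proj (Λ ∪ F \ Λ) x‖ ≤ ‖x - B.proj F x‖ := by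
    refine norm_le_of_coord_le fun n => ?_
    rw [← hB, B.coord_sub_proj, B.coord_sub_proj, Finset.union_sdiff_self_eq_union]
    by_cases h1 : n ∈ F
    · simp [h1]
    · by_cases h2 : n ∈ Λ <;> simp [h1, h2]
  have hsplit : x - B.proj Λ x = (x - B.proj (Λ ∪ F \ Λ) x) + B.proj (F \ Λ) x := by
    rw [B.proj_union Finset.disjoint_sdiff]; abel
  rw [hsplit, two_mul]
  exact (norm_add_le _ _).trans (add_le_add hunion hproj)

/-- The canonical basis of the direct sum of `ℓ₁(D)` and `c₀(Dᶜ)` is not strong partially greedy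
if both summands are infinite dimensional. -/
lemma not_isStrongPartiallyGreedy_basis (hD : D.Infinite) (hD' : Dᶜ.Infinite) :
    ¬ (basis.{u} 𝕜 D).IsStrongPartiallyGreedy := by
  classical
  rintro ⟨C, hC, h⟩
  set B := basis.{u} 𝕜 D with hB
  -- Test vector: the sum of the `e n` over `[0, N)`, which contains `L > C` points of `D`, and over
  -- `N` later points `E` of `Dᶜ`. All its nonzero coefficients are `1`, so `E` is greedy; removing
  -- `E` leaves norm at least `L`, removing `[0, N)` at most `1`.
  obtain ⟨L, hL⟩ := exists_nat_gt C
  obtain ⟨A, hAD, hA⟩ := hD.exists_subset_card_eq L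
  obtain ⟨N, hN0, hAN⟩ : ∃ N, 1 ≤ N ∧ A ⊆ Finset.range N := by
    obtain ⟨N, hN⟩ := A.exists_nat_subset_range
    exact ⟨N + 1, by omega, hN.trans (Finset.range_subset_range.2 (by omega))⟩
  obtain ⟨E, hE, hEcard⟩ :=
    (hD'.sdiff (Finset.range N).finite_toSet).exists_subset_card_eq N
  have hdisj : Disjoint (Finset.range N) E :=
    Finset.disjoint_right.2 fun n hn hn' => (hE hn).2 hn'
  set x : MixedSpace.{u} 𝕜 D := ∑ n ∈ Finset.range N ∪ E, B.e n with hx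
  have cx : ∀ n, B.coord n x = if n ∈ Finset.range N ∪ E then 1 else 0 := by
    intro n; simp only [hx, map_sum, B.biorthogonal, Finset.sum_ite_eq]
  have hxp : x = B.proj (Finset.range N) x + B.proj E x := by
    rw [← B.proj_union hdisj, SemiNormalizedBasis.proj]
    conv_lhs => rw [hx]
    exact Finset.sum_congr rfl fun n hn => by rw [cx, if_pos hn, one_smul]
  have key := h x N E hN0 ⟨hEcard, fun i hi j _ => ?_⟩ N le_rfl
  · have e1 : x - B.proj E x = B.proj (Finset.range N) x := by
      nth_rewrite 1 [hxp]; abel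
    have e2 : x - B.partialSum N x = B.proj E x := by
      rw [SemiNormalizedBasis.partialSum]; nth_rewrite 1 [hxp]; abel
    rw [e1, e2] at key
    have hsmall : ‖B.proj E x‖ ≤ 1 := by
      refine max_le ?_ (norm_sndPart_proj_le zero_le_one fun n hn => ?_)
      · change ‖fstPart.{u} 𝕜 D (B.proj E x)‖ ≤ _
        rw [norm_fstPart_proj, Finset.sum_eq_zero]
        · exact zero_le_one
        · intro n hn
          rw [Finset.mem_filter] at hn
          exact absurd hn.2 (hE hn.1).1
      · rw [← hB, cx]; split_ifs <;> simp
    have hlarge : (L : ℝ) ≤ ‖B.proj (Finset.range N) x‖ := by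
      refine le_trans ?_ (norm_fstPart_le _)
      rw [norm_fstPart_proj, ← hA]
      calc (A.card : ℝ) = ∑ n ∈ A, ‖B.coord n x‖ := by
            rw [Finset.card_eq_sum_ones, Nat.cast_sum]
            refine Finset.sum_congr rfl fun n hn => ?_
            rw [cx, if_pos (Finset.mem_union_left _ (hAN hn))]; simp
        _ ≤ _ := Finset.sum_le_sum_of_subset_of_nonneg
            (fun n hn => Finset.mem_filter.2 ⟨hAN hn, hAD hn⟩) fun _ _ _ => norm_nonneg _
    nlinarith
  · rw [cx, cx, if_pos (Finset.mem_union_right _ hi)]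
    split_ifs <;> simp

end MixedSpace

end MixedSpace

theorem theorem2p3 {𝕜 : Type} [RCLike 𝕜] {p : ℝ} (hp0 : 0 < p) (hp1 : p ≤ 1)
    (a : ℕ → ℕ) (ha : ∀ n, 0 < a n) :
    BddAbove (Set.range a) ↔
      ∀ (X : Type u) [AddCommGroup X] [Module 𝕜 X] [Norm X] [PBanachSpace p 𝕜 X]
        (B : SemiNormalizedBasis 𝕜 X),
        B.IsFamilyStrongPartiallyGreedy (gapFamily a) ↔ B.IsStrongPartiallyGreedy := by
  constructor
  · intro hbdd X _ _ _ hX B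
    exact ⟨SemiNormalizedBasis.isStrongPartiallyGreedy_of_gapFamily hX hp0 ha hbdd,
      fun h => h.isFamilyStrongPartiallyGreedy hX hp0 _⟩
  · intro h
    by_contra hunb
    obtain ⟨D, hD, hD', hsub⟩ := exists_infinite_subsingleton_inter ha hunb
    have : CompleteSpace (MixedSpace.{u} 𝕜 D) :=
      (Submodule.isClosed_topologicalClosure _).completeSpace_coe
    have := PBanachSpace.of_completeSpace hp0 hp1 𝕜 (MixedSpace.{u} 𝕜 D)
    exact MixedSpace.not_isStrongPartiallyGreedy_basis hD hD'
      ((h _ (MixedSpace.basis.{u} 𝕜 D)).1 (MixedSpace.isFamilyStrongPartiallyGreedy_basis hsub))
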